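/- \textbf{Definitions.} An \emph{effect algebra} is a set $A$ with a partial binary operation $+$ and constants $0,1$ (where $0=1$ is allowed) such that: (E1) if $a+b$ is defined, then so is $b+a$, and $a+b=b+a$; (E2) if $a+b$ and $(a+b)+c$ are defined, then so are $b+c$ and $a+(b+c)$, and $(a+b)+c=a+(b+c)$; (E3) for every $a$ there is a unique $a^\perp$ such that $a+a^\perp$ is defined and equal to $1$; (E4) if $a+1$ is defined, then $a=0$. A \emph{morphism} is a map $f$ with $f(1)=1$ such that whenever $a+b$ is defined, so is $f(a)+f(b)$, and $f(a+b)=f(a)+f(b)$. Let $\mathbf{EA}$ be the resulting category. Every Boolean algebra is an effect algebra, where $x+y$ is defined iff $x\wedge y=0$, and then $x+y=x\vee y$. Let $\mathbf{FinBool}$ be the full subcategory of the category of Boolean algebras spanned by the power sets $2^{[n]}$, $n\in\mathbb N$, $[n]=\{1,\dots,n\}$, let $*$ be its binary coproduct (the free product of Boolean algebras), and let $E\colon\mathbf{FinBool}\to\mathbf{EA}$ be the inclusion. Let $R\colon\mathbf{EA}\to[\mathbf{FinBool}^{op},\mathbf{Set}]$ be given by $R(A)=\mathbf{EA}(E(-),A)$,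 acting by composition. For effect algebras $A,B,C$, a $C$-valued \emph{bimorphism} from $A,B$ is a map $h\colon A\times B\to C$ with $h(1,1)=1$ that is additive in each variable separately: if $a_1+a_2$ is defined, then so is $h(a_1,b)+h(a_2,b)$, and it equals $h(a_1+a_2,b)$; similarly in the second variable. The bimorphisms from $A,B$ form a category, whose arrows from $h\colon A\times B\to C$ to $h'\colon A\times B\to C'$ are the morphisms $f\colon C\to C'$ in $\mathbf{EA}$ with $f\circ h=h'$. The \emph{tensor product} $A\otimes B$ is the codomain of an initial object of this category. For presheaves $X,Y$ on $\mathbf{FinBool}$, their \emph{Day convolution} with respect to $*$ is the presheaf $$X\otimes_{\mathrm{Day}}Y=\int^{(c_1,c_2)}\mathbf{FinBool}(-,c_1*c_2)\times X(c_1)\times Y(c_2).$$ \textbf{Theorem.} The functor $R$ has a left adjoint $L$, and for every pair $A,B$ of effect algebras the tensor product $A\otimes B$ and the Day convolution $R(A)\otimes_{\mathrm{Day}}R(B)$ exist, and $$A\otimes B\;\simeq\;L\bigl(R(A)\otimes_{\mathrm{Day}}R(B)\bigr)$$ in $\mathbf{EA}$ (for any choice of $L$, of the tensor product and of the Day convolution,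 each of which is determined up to isomorphism). -/

import Mathlib

open CategoryTheory

universe u v

/-! ### Effect algebras and their morphisms -/

/-- An effect algebra. The partial sum is an `Option`-valued operation:
`padd a b = some c` means that `a + b` is defined and equal to `c`, and `padd a b = none` means
that `a + b` is undefined. One-element effect algebras (`zero = one`) are allowed. -/
class EffectAlgebra (A : Type u) where
  /-- the partial sum -/
  padd : A → A → Option A
  /-- the constant `0` -/
  zero : A
  /-- the constant `1` -/
  one : A
  padd_comm : ∀ {a b c : A}, padd a b = some c → padd b a = some c
  padd_assoc : ∀ {a b c s t : A}, padd a b = some s → padd s c = some t →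
    ∃ r, padd b c = some r ∧ padd a r = some t
  existsUnique_orthosupplement : ∀ a : A, ∃! b : A, padd a b = some one
  eq_zero_of_padd_one : ∀ {a c : A}, padd a one = some c → a = zero

/-- Morphisms of effect algebras: maps that preserve `1` and every sum that is defined. -/
@[ext]
structure EAHom (A : Type u) (B : Type v) [EffectAlgebra A] [EffectAlgebra B] where
  /-- the underlying map -/
  toFun : A → B
  map_one : toFun EffectAlgebra.one = EffectAlgebra.one
  map_padd : ∀ {a b c : A}, EffectAlgebra.padd a b = some c →
    EffectAlgebra.padd (toFun a) (toFun b) = some (toFun c)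

/-- The category of effect algebras: bundled objects. -/
structure EA where
  /-- the underlying set -/
  carrier : Type u
  [str : EffectAlgebra carrier]

namespace EA

attribute [instance] EA.str

instance : LargeCategory EA.{u} where
  Hom A B := EAHom A.carrier B.carrier
  id A := { toFun := fun a => a, map_one := rfl, map_padd := fun h => h }
  comp f g :=
    { toFun := fun a => g.toFun (f.toFun a)
      map_one := by rw [f.map_one, g.map_one]
      map_padd := fun h => g.map_padd (f.map_padd h) }

end EA

/-! ### Boolean algebras as effect algebras -/

open Classical in
/-- A Boolean algebra as an effect algebra: `x + y` is defined if and only if `x ⊓ y = ⊥`, and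
then `x + y = x ⊔ y`. -/
@[reducible]
noncomputable def BooleanAlgebra.toEffectAlgebra (X : Type u) [BooleanAlgebra X] :
    EffectAlgebra X where
  padd x y := if x ⊓ y = ⊥ then some (x ⊔ y) else none
  zero := ⊥
  one := ⊤
  padd_comm {a b c} h := by
    rw [inf_comm, sup_comm]; exact h
  padd_assoc {a b c s t} h₁ h₂ := by
    split_ifs at h₁ with hab
    obtain rfl : a ⊔ b = s := by simpa using h₁
    split_ifs at h₂ with habc
    obtain rfl : (a ⊔ b) ⊔ c = t := by simpa using h₂
    rw [inf_sup_right, sup_eq_bot_iff] at habc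
    refine ⟨b ⊔ c, if_pos habc.2, ?_⟩
    rw [if_pos (by rw [inf_sup_left, hab, habc.1, sup_bot_eq]), sup_assoc]
  existsUnique_orthosupplement a := by
    refine ⟨aᶜ, by simp, fun b hb => ?_⟩
    dsimp only at hb
    split_ifs at hb with hab
    have h : a ⊔ b = ⊤ := by simpa using hb
    exact (IsCompl.of_eq hab h).compl_eq.symm
  eq_zero_of_padd_one {a c} h := by
    split_ifs at h with ha
    simpa using ha

open Classical in
/-- The inclusion of the category of Boolean algebras into the category of effect algebras. -/
noncomputable def boolAlgToEA : BoolAlg.{u} ⥤ EA.{u} where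
  obj X := @EA.mk X (BooleanAlgebra.toEffectAlgebra X)
  map {X Y} f :=
    letI := BooleanAlgebra.toEffectAlgebra X
    letI := BooleanAlgebra.toEffectAlgebra Y
    show EAHom X Y from
    { toFun := fun x => f.hom x
      map_one := map_top f.hom
      map_padd := by
        intro a b c h
        change (if a ⊓ b = ⊥ then some (a ⊔ b) else none) = some c at h
        change (if f.hom a ⊓ f.hom b = ⊥ then some (f.hom a ⊔ f.hom b) else none) = some (f.hom c)
        split_ifs at h with hab
        obtain rfl : a ⊔ b = c := by simpa using h
        rw [if_pos (by rw [← map_inf, hab, map_bot]), map_sup] }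
  map_id _ := rfl
  map_comp _ _ := rfl

/-! ### Finite Boolean algebras -/

/-- The Boolean algebra `2^[n]` of all subsets of an `n`-element set (in universe `u`). -/
abbrev finPowerset (n : ℕ) : BoolAlg.{u} := BoolAlg.of (Set (ULift.{u} (Fin n)))

/-- The full subcategory of the category of Boolean algebras spanned by the `2^[n]`, `n : ℕ`. -/
abbrev FinBool : Type := InducedCategory BoolAlg.{u} finPowerset.{u}

namespace FinBool

/-- The inclusion `E` of finite Boolean algebras into effect algebras. -/
noncomputable def toEA : FinBool.{u} ⥤ EA.{u} := inducedFunctor finPowerset.{u} ⋙ boolAlgToEA.{u}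

/-- The morphism `2^[n] ⟶ 2^[m]` given by preimages along a map `[m] → [n]`. -/
def ofMap {n m : FinBool.{u}} (φ : ULift.{u} (Fin m) → ULift.{u} (Fin n)) : n ⟶ m :=
  InducedCategory.homMk (BoolAlg.ofHom (X := Set (ULift.{u} (Fin n)))
    (Y := Set (ULift.{u} (Fin m)))
    { toFun := fun X => φ ⁻¹' X
      map_sup' := fun _ _ => rfl
      map_inf' := fun _ _ => rfl
      map_top' := rfl
      map_bot' := rfl })

theorem exists_preimage {α β : Type u} [Finite α] (f : BoundedLatticeHom (Set α) (Set β)) :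
    ∃ φ : β → α, ∀ X, f X = φ ⁻¹' X := by
  classical
  have := Fintype.ofFinite α
  have h : ∀ b : β, ∃ a : α, b ∈ f {a} := by
    intro b
    have h1 : (Finset.univ : Finset α).sup (fun a => ({a} : Set α)) = ⊤ := by
      refine top_unique fun a _ => ?_
      exact Finset.le_sup (f := fun a => ({a} : Set α)) (Finset.mem_univ a) rfl
    have h2 : b ∈ f ((Finset.univ : Finset α).sup (fun a => ({a} : Set α))) := by
      rw [h1, map_top]; trivial
    rw [map_finset_sup, Finset.sup_eq_iSup] at h2
    simpa using h2
  choose φ hφ using h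
  refine ⟨φ, fun X => Set.ext fun b => ⟨fun hb => ?_, fun hb => ?_⟩⟩
  · by_contra hn
    have h3 : ({φ b} : Set α) ≤ Xᶜ := by simpa using hn
    have h4 := OrderHomClass.mono f h3 (hφ b)
    rw [map_compl'] at h4
    exact h4 hb
  · have h3 : ({φ b} : Set α) ≤ X := by simpa using hb
    exact OrderHomClass.mono f h3 (hφ b)

theorem exists_ofMap {n m : FinBool.{u}} (f : n ⟶ m) :
    ∃ φ : ULift.{u} (Fin m) → ULift.{u} (Fin n), f = ofMap φ := by
  obtain ⟨φ, hφ⟩ := exists_preimage (α := ULift.{u} (Fin n)) (β := ULift.{u} (Fin m)) f.hom.hom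
  exact ⟨φ, InducedCategory.hom_ext (BoolAlg.ext hφ)⟩

theorem ofMap_injective {n m : FinBool.{u}} {φ ψ : ULift.{u} (Fin m) → ULift.{u} (Fin n)}
    (h : ofMap φ = (ofMap ψ : n ⟶ m)) : φ = ψ := by
  funext k
  have h1 : φ ⁻¹' {ψ k} = ψ ⁻¹' {ψ k} :=
    congrArg (fun f : n ⟶ m => f.hom.hom ({ψ k} : Set (ULift.{u} (Fin n)))) h
  have h2 : k ∈ φ ⁻¹' {ψ k} := by rw [h1]; rfl
  exact h2

theorem ofMap_comp {n m k : FinBool.{u}} (φ : ULift.{u} (Fin m) → ULift.{u} (Fin n))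
    (ψ : ULift.{u} (Fin k) → ULift.{u} (Fin m)) :
    (ofMap φ : n ⟶ m) ≫ (ofMap ψ : m ⟶ k) = ofMap (φ ∘ ψ) := rfl

/-- The object `2^[n * m]`. -/
def prodObj (n m : FinBool.{u}) : FinBool.{u} := Nat.mul n m

/-- `2^[n * m]`, identified with `2^([n] × [m])`, as a cofan on `2^[n]` and `2^[m]`. -/
def coprodCofan (n m : FinBool.{u}) : Limits.BinaryCofan n m :=
  Limits.BinaryCofan.mk (P := prodObj n m)
    (ofMap fun k => ⟨((finProdFinEquiv (m := n) (n := m)).symm k.down).1⟩)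
    (ofMap fun k => ⟨((finProdFinEquiv (m := n) (n := m)).symm k.down).2⟩)

theorem coprodCofan_isColimit (n m : FinBool.{u}) :
    Nonempty (Limits.IsColimit (coprodCofan n m)) := by
  refine ⟨Limits.BinaryCofan.IsColimit.mk _
    (fun {k} f g => ofMap (n := prodObj n m) fun j => ⟨finProdFinEquiv (m := n) (n := m)
      ((Classical.choose (exists_ofMap f) j).down, (Classical.choose (exists_ofMap g) j).down)⟩)
    ?_ ?_ ?_⟩
  · intro k f g
    refine Eq.trans ?_ (Classical.choose_spec (exists_ofMap f)).symm
    refine (ofMap_comp _ _).trans (congrArg ofMap ?_)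
    funext j
    exact ULift.ext _ _ (congrArg Prod.fst
      (Equiv.symm_apply_apply (finProdFinEquiv (m := n) (n := m)) _))
  · intro k f g
    refine Eq.trans ?_ (Classical.choose_spec (exists_ofMap g)).symm
    refine (ofMap_comp _ _).trans (congrArg ofMap ?_)
    funext j
    exact ULift.ext _ _ (congrArg Prod.snd
      (Equiv.symm_apply_apply (finProdFinEquiv (m := n) (n := m)) _))
  · intro k f g h hf hg
    obtain ⟨χ, rfl⟩ := exists_ofMap h
    have h1 := ofMap_injective ((ofMap_comp _ _).symm.trans
      (hf.trans (Classical.choose_spec (exists_ofMap f))))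
    have h2 := ofMap_injective ((ofMap_comp _ _).symm.trans
      (hg.trans (Classical.choose_spec (exists_ofMap g))))
    refine congrArg ofMap ?_
    funext j
    rw [← h1, ← h2]
    exact ULift.ext _ _ (Equiv.apply_symm_apply (finProdFinEquiv (m := n) (n := m)) _).symm

instance : Limits.HasBinaryCoproducts FinBool.{u} :=
  have : ∀ n m : FinBool.{u}, Limits.HasColimit (Limits.pair n m) := fun n m =>
    ⟨⟨⟨_, (coprodCofan_isColimit n m).some⟩⟩⟩
  Limits.hasBinaryCoproducts_of_hasColimit_pair _

instance : Limits.HasInitial FinBool.{u} := by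
  refine Limits.IsInitial.hasInitial (X := ((1 : ℕ) : FinBool.{u}))
    (Limits.IsInitial.ofUniqueHom (fun k => ofMap fun _ => ⟨0⟩) ?_)
  intro k f
  obtain ⟨χ, rfl⟩ := exists_ofMap f
  refine congrArg ofMap ?_
  funext j
  exact ULift.ext _ _ (Subsingleton.elim (α := Fin 1) _ _)

/-- The monoidal structure on finite Boolean algebras given by the free product, that is, by the
binary coproduct, with the initial object `2^[1]` as unit. Presheaves live on the opposite
category, with the opposite monoidal structure. -/
noncomputable instance : MonoidalCategory FinBool.{u} := monoidalOfHasFiniteCoproducts FinBool.{u}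

end FinBool

/-! ### The presheaf representation -/

/-- The presheaf representation `R`, `R(A) = EA(E(-), A)`, acting by precomposition. -/
noncomputable def EA.presheafRepr : EA.{u} ⥤ (FinBool.{u}ᵒᵖ ⥤ Type u) :=
  yoneda ⋙ (Functor.whiskeringLeft FinBool.{u}ᵒᵖ EA.{u}ᵒᵖ (Type u)).obj FinBool.toEA.{u}.op

/-! ### Bimorphisms and tensor products -/

/-- `C`-valued bimorphisms from `A, B`. -/
@[ext]
structure EABimorphism (A B C : EA.{u}) where
  /-- the underlying map -/
  toFun : A.carrier × B.carrier → C.carrier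
  map_one_one : toFun (EffectAlgebra.one, EffectAlgebra.one) = EffectAlgebra.one
  map_padd_left : ∀ (b : B.carrier) {a₁ a₂ a : A.carrier}, EffectAlgebra.padd a₁ a₂ = some a →
    EffectAlgebra.padd (toFun (a₁, b)) (toFun (a₂, b)) = some (toFun (a, b))
  map_padd_right : ∀ (a : A.carrier) {b₁ b₂ b : B.carrier}, EffectAlgebra.padd b₁ b₂ = some b →
    EffectAlgebra.padd (toFun (a, b₁)) (toFun (a, b₂)) = some (toFun (a, b))

/-- The functor that sends `C` to the set of `C`-valued bimorphisms from `A, B`; morphisms act by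
composition. -/
def EABimorphism.functor (A B : EA.{u}) : EA.{u} ⥤ Type u where
  obj C := EABimorphism A B C
  map {C C'} f := TypeCat.ofHom fun h : EABimorphism A B C =>
    (show EABimorphism A B C' from
    { toFun := fun x => EAHom.toFun f (h.toFun x)
      map_one_one := by rw [h.map_one_one]; exact EAHom.map_one f
      map_padd_left := fun b _ _ _ hs => EAHom.map_padd f (h.map_padd_left b hs)
      map_padd_right := fun a _ _ _ hs => EAHom.map_padd f (h.map_padd_right a hs) })
  map_id _ := rfl
  map_comp _ _ := rfl

/-- The category of bimorphisms from `A, B`: objects are pairs `(C, h)` of an effect algebra `C`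
and a `C`-valued bimorphism `h`; arrows `(C, h) ⟶ (C', h')` are morphisms `f : C ⟶ C'` of effect
algebras with `f ∘ h = h'`. -/
abbrev EABimorphismCat (A B : EA.{u}) := (EABimorphism.functor A B).Elements

/-- A tensor product of `A` and `B` is an initial object of the category of bimorphisms from
`A, B`; the underlying effect algebra of `T` is `T.1`. -/
abbrev IsEATensorProduct {A B : EA.{u}} (T : EABimorphismCat A B) := Limits.IsInitial T

/-! Both sides corepresent the functor of bimorphisms from `A, B`. By the adjunction and the
universal property of Day convolution, morphisms `L(R(A) ⊗ R(B)) ⟶ C` are families `EA(E n, A) ×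
EA(E m, B) → EA(E (n * m), C)` natural in `n` and `m`.

A morphism out of `2^[n]` is an `n`-tuple with sum `1`, and the atoms of `2^[n] * 2^[m]` are the
products of atoms. So a bimorphism `h` takes tuples `(a_i)`, `(b_j)` to the tuple `(h(a_i, b_j))`,
whose sum is `h(1, 1) = 1` (`exists_hom_rect`). Conversely, the value of a natural family at a
rectangle `x * y` depends only on the elements `f x` and `g y`, by naturality along maps out of
`2^[2]` (`component_rect_congr`). This defines a function on `A × B`, additive in each variable
because every defined sum comes from a sum of atoms of `2^[3]` (`exists_pow_three`).

The left adjoint `L` comes from the general adjoint functor theorem: `EA` has limits, `R` preserves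
them, and subalgebras generated by a small set form a solution set. -/

namespace EffectAlgebra

/-! ### Elementary arithmetic in effect algebras. -/

section Basic

variable {A : Type u} [EffectAlgebra A]

theorem padd_comm' (a b : A) : padd a b = padd b a := by
  cases h : padd a b with
  | some c => exact (padd_comm h).symm
  | none =>
    cases h' : padd b a with
    | none => rfl
    | some c => rw [padd_comm h'] at h; cases h

/-- The orthosupplement of an element. -/
noncomputable def compl (a : A) : A := Classical.choose (existsUnique_orthosupplement a)

theorem padd_compl (a : A) : padd a (compl a) = some one :=
  (Classical.choose_spec (existsUnique_orthosupplement a)).1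

theorem eq_compl {a b : A} (h : padd a b = some one) : b = compl a :=
  (Classical.choose_spec (existsUnique_orthosupplement a)).2 b h

theorem compl_one : compl (one : A) = zero :=
  eq_zero_of_padd_one (padd_comm (padd_compl one))

theorem padd_one_zero : padd (one : A) zero = some one := by
  rw [← compl_one]; exact padd_compl _

theorem compl_compl (a : A) : compl (compl a) = a :=
  (eq_compl (padd_comm (padd_compl a))).symm

/-- Reassociating `(compl a + a) + 0 = 1` shows that `a + 0` is defined and is an orthosupplement of
`compl a`, hence equals `a`. -/
theorem padd_zero (a : A) : padd a zero = some a := by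
  have h := padd_comm (padd_compl a)
  obtain ⟨r, hr, h'⟩ := padd_assoc h padd_one_zero
  rw [hr, eq_compl h', compl_compl]

theorem zero_padd (a : A) : padd zero a = some a := padd_comm (padd_zero a)

/-- Reassociating `(b + a) + compl a` makes `b + 1` defined, so (E4) applies. -/
theorem eq_zero_of_padd_self {a b : A} (h : padd a b = some a) : b = zero := by
  obtain ⟨r, hr, hr'⟩ := padd_assoc (padd_comm h) (padd_compl a)
  rw [padd_compl] at hr
  cases hr
  exact eq_zero_of_padd_one hr'

end Basic

/-! ### Subalgebras and products. -/

section Induced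

variable {Q : Type v} {A : Type u} [EffectAlgebra A] (e : Q → A)

open Classical in
/-- The partial sum induced along a map `e`: `a + b` is an element that `e` sends to
`e a + e b`, if there is one. -/
noncomputable def inducedPadd (a b : Q) : Option Q :=
  if h : ∃ c, padd (e a) (e b) = some (e c) then some h.choose else none

variable {e}

theorem inducedPadd_eq_some_iff (he : Function.Injective e) {a b c : Q} :
    inducedPadd e a b = some c ↔ padd (e a) (e b) = some (e c) := by
  unfold inducedPadd
  split_ifs with h
  · exact Option.some_inj.trans (he.eq_iff.symm.trans
      (Option.some_inj.symm.trans (by rw [← h.choose_spec])))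
  · exact ⟨fun h' => (nomatch h'), fun h' => (h ⟨c, h'⟩).elim⟩

variable (he : Function.Injective e) (h1 : ∃ q, e q = one) (hc : ∀ q, ∃ q', e q' = compl (e q))
  (ha : ∀ {q q' : Q} {c : A}, padd (e q) (e q') = some c → ∃ r, e r = c)

/-- The effect algebra structure induced along an injective map whose range is closed under `1`,
orthosupplements and all defined sums. -/
@[reducible]
noncomputable def induced : EffectAlgebra Q :=
  have h0 : ∃ q, e q = zero := by
    obtain ⟨q, hq⟩ := h1
    obtain ⟨q', hq'⟩ := hc q
    exact ⟨q', by rw [hq', hq, compl_one]⟩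
  { padd := inducedPadd e
    zero := h0.choose
    one := h1.choose
    padd_comm := fun h => by
      rw [inducedPadd_eq_some_iff he] at h ⊢
      exact padd_comm h
    padd_assoc := fun h h' => by
      rw [inducedPadd_eq_some_iff he] at h h'
      obtain ⟨r, hr, hr'⟩ := padd_assoc h h'
      obtain ⟨q, rfl⟩ := ha hr
      exact ⟨q, (inducedPadd_eq_some_iff he).2 hr, (inducedPadd_eq_some_iff he).2 hr'⟩
    existsUnique_orthosupplement := fun a => by
      simp only [inducedPadd_eq_some_iff he, h1.choose_spec]
      obtain ⟨q, hq⟩ := hc a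
      refine ⟨q, by simp only [hq]; exact padd_compl _, fun y hy => he ?_⟩
      rw [eq_compl hy, hq]
    eq_zero_of_padd_one := fun {a c} h => by
      rw [inducedPadd_eq_some_iff he, h1.choose_spec] at h
      exact he (by rw [h0.choose_spec, eq_zero_of_padd_one h]) }

theorem induced_one : e (induced he h1 hc ha).one = one := h1.choose_spec

theorem induced_padd_iff {a b c : Q} :
    (induced he h1 hc ha).padd a b = some c ↔ padd (e a) (e b) = some (e c) :=
  inducedPadd_eq_some_iff he

end Induced

section Pi

variable {ι : Type v} {A : ι → Type u} [∀ i, EffectAlgebra (A i)]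

open Classical in
/-- The componentwise partial sum of families, defined if all components are defined. -/
noncomputable def piPadd (a b : ∀ i, A i) : Option (∀ i, A i) :=
  if h : ∃ c : ∀ i, A i, ∀ i, padd (a i) (b i) = some (c i) then some h.choose else none

theorem piPadd_eq_some_iff {a b c : ∀ i, A i} :
    piPadd a b = some c ↔ ∀ i, padd (a i) (b i) = some (c i) := by
  unfold piPadd
  split_ifs with h
  · exact Option.some_inj.trans (funext_iff.trans (forall_congr' fun i =>
      Option.some_inj.symm.trans (by rw [← h.choose_spec i])))
  · exact ⟨fun h' => (nomatch h'), fun h' => (h ⟨c, h'⟩).elim⟩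

/-- The product of a family of effect algebras: sums are defined componentwise. -/
noncomputable instance pi : EffectAlgebra (∀ i, A i) where
  padd := piPadd
  zero _ := zero
  one _ := one
  padd_comm h := by
    rw [piPadd_eq_some_iff] at h ⊢
    exact fun i => padd_comm (h i)
  padd_assoc h h' := by
    rw [piPadd_eq_some_iff] at h h'
    choose r hr hr' using fun i => padd_assoc (h i) (h' i)
    exact ⟨r, piPadd_eq_some_iff.2 hr, piPadd_eq_some_iff.2 hr'⟩
  existsUnique_orthosupplement a := by
    simp only [piPadd_eq_some_iff]
    exact ⟨fun i => compl (a i), fun i => padd_compl _, fun y hy =>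
      funext fun i => eq_compl (hy i)⟩
  eq_zero_of_padd_one h := by
    rw [piPadd_eq_some_iff] at h
    exact funext fun i => eq_zero_of_padd_one (h i)

theorem pi_padd_iff {a b c : ∀ i, A i} :
    padd a b = some c ↔ ∀ i, padd (a i) (b i) = some (c i) :=
  piPadd_eq_some_iff

theorem pi_compl (a : ∀ i, A i) : compl a = fun i => compl (a i) :=
  (eq_compl (pi_padd_iff.2 fun i => padd_compl (a i))).symm

end Pi

end EffectAlgebra

namespace EAHom

open EffectAlgebra

variable {A : Type u} {B : Type v} [EffectAlgebra A] [EffectAlgebra B] (f : EAHom A B)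

theorem map_compl (a : A) : f.toFun (compl a) = compl (f.toFun a) :=
  eq_compl (by rw [f.map_padd (padd_compl a), f.map_one])

theorem map_zero : f.toFun zero = zero := by
  rw [← compl_one, map_compl, map_one, compl_one]

end EAHom

/-! ### Limits of effect algebras and the left adjoint of `R`. -/

namespace EA

open EffectAlgebra Limits

@[ext]
theorem hom_ext {A B : EA.{u}} {f g : A ⟶ B} (h : ∀ a, EAHom.toFun f a = EAHom.toFun g a) :
    f = g :=
  EAHom.ext (funext h)

section Limits

variable {J : Type u} [SmallCategory J] (F : J ⥤ EA.{u})

/-- The sections of a diagram of effect algebras. -/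
def Sections : Type u :=
  {s : ∀ j, (F.obj j).carrier // ∀ ⦃i j⦄ (f : i ⟶ j), EAHom.toFun (F.map f) (s i) = s j}

namespace Sections

theorem exists_one : ∃ s : Sections F, s.1 = one :=
  ⟨⟨fun _ => one, fun _ _ f => EAHom.map_one (F.map f)⟩, rfl⟩

variable {F}

theorem exists_compl (s : Sections F) : ∃ t : Sections F, t.1 = compl s.1 :=
  ⟨⟨fun j => compl (s.1 j), fun _ _ f => by rw [EAHom.map_compl, s.2 f]⟩, (pi_compl _).symm⟩

theorem exists_padd {s t : Sections F} {c : ∀ j, (F.obj j).carrier}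
    (h : padd s.1 t.1 = some c) : ∃ r : Sections F, r.1 = c := by
  rw [pi_padd_iff] at h
  refine ⟨⟨c, fun i j f => ?_⟩, rfl⟩
  have := EAHom.map_padd (F.map f) (h i)
  rw [s.2 f, t.2 f, h j] at this
  exact (Option.some.inj this).symm

noncomputable instance : EffectAlgebra (Sections F) :=
  induced Subtype.val_injective (exists_one F) exists_compl exists_padd

theorem one_val (j : J) : (one : Sections F).1 j = one :=
  congrFun (induced_one Subtype.val_injective (exists_one F) exists_compl exists_padd) j

theorem padd_iff {s t r : Sections F} :
    padd s t = some r ↔ ∀ j, padd (s.1 j) (t.1 j) = some (r.1 j) :=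
  (induced_padd_iff Subtype.val_injective (exists_one F) exists_compl exists_padd).trans
    pi_padd_iff

end Sections

/-- The limit cone of sections. -/
noncomputable def limitCone : Cone F where
  pt := ⟨Sections F⟩
  π :=
    { app := fun j => show EAHom (Sections F) (F.obj j).carrier from
        { toFun := fun s => s.1 j
          map_one := Sections.one_val j
          map_padd := fun h => Sections.padd_iff.1 h j }
      naturality := fun _ _ f => hom_ext fun s => (Subtype.property s f).symm }

/-- The cone of sections is a limit cone. -/
noncomputable def limitConeIsLimit : IsLimit (limitCone F) where
  lift c := show EAHom c.pt.carrier (Sections F) from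
    { toFun := fun x => ⟨fun j => EAHom.toFun (c.π.app j) x, fun _ _ f =>
        congrArg (fun k => EAHom.toFun k x) (c.w f)⟩
      map_one := Subtype.ext (funext fun j =>
        (EAHom.map_one (c.π.app j)).trans (Sections.one_val j).symm)
      map_padd := fun h => Sections.padd_iff.2 fun j => EAHom.map_padd (c.π.app j) h }
  fac _ _ := rfl
  uniq c _ hm := hom_ext fun x => Subtype.ext (funext fun j =>
    congrArg (fun f : c.pt ⟶ F.obj j => EAHom.toFun f x) (hm j))

instance : HasLimits EA.{u} :=
  ⟨fun _ _ => ⟨fun F => ⟨⟨⟨limitCone F, limitConeIsLimit F⟩⟩⟩⟩⟩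

end Limits

/-- Formal terms in the language of effect algebras with generators `G`. -/
inductive Term (G : Type u) : Type u
  | gen : G → Term G
  | one : Term G
  | compl : Term G → Term G
  | add : Term G → Term G → Term G

/-- The value of a formal term; undefined sums are evaluated to `0`. -/
noncomputable def Term.eval {G : Type u} {A : Type u} [EffectAlgebra A] (v : G → A) : Term G → A
  | .gen g => v g
  | .one => EffectAlgebra.one
  | .compl t => EffectAlgebra.compl (t.eval v)
  | .add s t => (padd (s.eval v) (t.eval v)).getD zero

/-- Every map from a set `G` to an effect algebra factors through a subalgebra whose underlying set
is a quotient of the set of formal terms in `G`. -/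
theorem exists_quotient_of_generators {G : Type u} (A : EA.{u}) (v : G → A.carrier) :
    ∃ (r : Setoid (Term G)) (_ : EffectAlgebra (Quotient r)) (e : Quotient r → A.carrier),
      Function.Injective e ∧ e one = one ∧
      (∀ a b c, padd a b = some c ↔ padd (e a) (e b) = some (e c)) ∧ ∀ g, ∃ q, e q = v g := by
  let r := Setoid.ker (Term.eval v)
  let e : Quotient r → A.carrier := Quotient.lift (Term.eval v) fun _ _ h => h
  have he : Function.Injective e := by
    rintro ⟨a⟩ ⟨b⟩ h
    exact Quotient.sound h
  have h1 : ∃ q, e q = one := ⟨Quotient.mk _ .one, rfl⟩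
  have hc : ∀ q, ∃ q', e q' = compl (e q) := by
    rintro ⟨t⟩
    exact ⟨Quotient.mk _ (.compl t), rfl⟩
  have ha : ∀ {q q' : Quotient r} {c : A.carrier}, padd (e q) (e q') = some c → ∃ r, e r = c := by
    rintro ⟨s⟩ ⟨t⟩ c h
    -- The default value `0` in `Term.eval` plays no role here, since the sum is defined by `h`.
    refine ⟨Quotient.mk _ (.add s t), ?_⟩
    change (padd (s.eval v) (t.eval v)).getD zero = c
    change padd (s.eval v) (t.eval v) = some c at h
    rw [h, Option.getD_some]
  exact ⟨r, induced he h1 hc ha, e, he, induced_one he h1 hc ha,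
    fun _ _ _ => induced_padd_iff he h1 hc ha, fun g => ⟨Quotient.mk _ (.gen g), rfl⟩⟩

/-- The Yoneda embedding and restriction along `E` both preserve limits. -/
instance : PreservesLimitsOfSize.{u, u} presheafRepr.{u} := by
  unfold presheafRepr
  infer_instance

/-- A map `X ⟶ R(A)` takes its values in the subalgebra generated by all elements `h(x)(y)`. That
subalgebra is a quotient of the terms over a set `G` depending only on `X`, so up to isomorphism
only a small set of subalgebras occurs. -/
theorem presheafRepr_solutionSetCondition :
    SolutionSetCondition.{u} presheafRepr.{u} := by
  intro X
  let G : Type u := Σ (n : FinBool.{u}), X.obj ⟨n⟩ × (FinBool.toEA.obj n).carrier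
  let ι : Type u := Σ (r : Setoid (Term G)) (s : EffectAlgebra (Quotient r)),
    (X ⟶ presheafRepr.obj ⟨Quotient r⟩)
  refine ⟨ι, fun i => @EA.mk _ i.2.1, fun i => i.2.2, fun A h => ?_⟩
  obtain ⟨r, s, e, he, h1, hp, hg⟩ := exists_quotient_of_generators A
    (fun g : G => EAHom.toFun (show FinBool.toEA.obj g.1 ⟶ A from h.app ⟨g.1⟩ g.2.1) g.2.2)
  -- `q` lifts the generators to the quotient; injectivity of `e` makes the lift additive in `y` and
  -- natural in `n`.
  choose q hq using hg
  let emb : EA.mk (Quotient r) ⟶ A := show EAHom _ _ from ⟨e, h1, fun h => (hp _ _ _).1 h⟩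
  let k : X ⟶ presheafRepr.obj (EA.mk (Quotient r)) :=
    { app := fun n => TypeCat.ofHom fun x =>
        show FinBool.toEA.obj n.unop ⟶ EA.mk (Quotient r) from
        show EAHom (FinBool.toEA.obj n.unop).carrier (Quotient r) from
          { toFun := fun y => q ⟨n.unop, x, y⟩
            map_one := he (by
              rw [hq, h1]
              exact EAHom.map_one (show FinBool.toEA.obj n.unop ⟶ A from h.app n x))
            map_padd := fun hs => (hp _ _ _).2 (by
              simp only [hq]
              exact EAHom.map_padd (show FinBool.toEA.obj n.unop ⟶ A from h.app n x) hs) }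
      naturality := fun _ _ f => by
        ext x
        refine hom_ext fun y => he ?_
        refine (hq _).trans (Eq.trans ?_ (hq _).symm)
        exact congrArg (fun t : FinBool.toEA.obj _ ⟶ A => EAHom.toFun t y)
          (ConcreteCategory.congr_hom (h.naturality f) x) }
  refine ⟨⟨r, s, k⟩, emb, ?_⟩
  ext n x
  exact hom_ext fun y => hq _

theorem presheafRepr_isRightAdjoint : presheafRepr.{u}.IsRightAdjoint :=
  isRightAdjoint_of_preservesLimits_of_solutionSetCondition _ presheafRepr_solutionSetCondition

end EA

/-! ### Finite sums in effect algebras. -/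

open EffectAlgebra

/-- An effect algebra with an absorbing element `none` adjoined. Setting undefined sums to `none`
turns the partial addition into a total commutative one, so that finite sums are available. -/
def PartialSum (A : Type u) : Type u := Option A

namespace PartialSum

variable {A : Type u} [EffectAlgebra A]

/-- The inclusion of an effect algebra. -/
def of (a : A) : PartialSum A := some a

theorem of_injective {A : Type u} : Function.Injective (of : A → PartialSum A) :=
  fun _ _ h => Option.some.inj h

instance : Add (PartialSum A) := ⟨fun x y => Option.bind x fun a => Option.bind y fun b => padd a b⟩

instance : Zero (PartialSum A) := ⟨of zero⟩

theorem of_zero : of (zero : A) = 0 := rfl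

theorem of_add_of_eq_iff {a b c : A} : of a + of b = of c ↔ padd a b = some c := Iff.rfl

theorem exists_of_add_eq {x y : PartialSum A} {c : A} (h : x + y = of c) :
    ∃ a b, x = of a ∧ y = of b := by
  obtain ⟨a, rfl, h'⟩ := Option.bind_eq_some_iff.1 h
  obtain ⟨b, rfl, -⟩ := Option.bind_eq_some_iff.1 h'
  exact ⟨a, b, rfl, rfl⟩

theorem add_comm' (x y : PartialSum A) : x + y = y + x := by
  cases x with
  | none => cases y <;> rfl
  | some a =>
    cases y with
    | none => rfl
    | some b => exact padd_comm' a b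

theorem add_assoc_of_eq {x y z : PartialSum A} {t : A} (h : x + y + z = of t) :
    x + (y + z) = of t := by
  obtain ⟨s, c, hs, rfl⟩ := exists_of_add_eq h
  obtain ⟨a, b, rfl, rfl⟩ := exists_of_add_eq hs
  rw [hs] at h
  obtain ⟨r, hr, hr'⟩ := padd_assoc hs h
  rw [of_add_of_eq_iff.2 hr]
  exact hr'

instance : AddCommMonoid (PartialSum A) where
  add_comm := add_comm'
  add_assoc x y z := by
    cases h : x + y + z with
    | some t => exact (add_assoc_of_eq h).symm
    | none =>
      cases h' : x + (y + z) with
      | none => rfl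
      | some t =>
        -- Reversing the order of the summands reduces this bracketing to the one already treated.
        rw [add_comm', add_comm' y] at h'
        have := add_assoc_of_eq h'
        rw [add_comm', add_comm' y, h] at this
        cases this
  zero_add x := by
    cases x with
    | none => rfl
    | some a => exact zero_padd a
  add_zero x := by
    cases x with
    | none => rfl
    | some a => exact padd_zero a
  nsmul := nsmulRec

/-- Preservation of `1` is not assumed, so that this applies to a bimorphism with one variable
fixed. -/
theorem sum_map {B : Type v} [EffectAlgebra B] (k : A → B) (h0 : k zero = zero)
    (hk : ∀ {a b c : A}, padd a b = some c → padd (k a) (k b) = some (k c))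
    {ι : Type*} (S : Finset ι) (a : ι → A) (s : A) (h : ∑ i ∈ S, of (a i) = of s) :
    ∑ i ∈ S, of (k (a i)) = of (k s) := by
  classical
  induction S using Finset.induction_on generalizing s with
  | empty =>
    rw [Finset.sum_empty, ← of_zero] at h ⊢
    rw [← of_injective h, h0]
  | insert i S hi ih =>
    rw [Finset.sum_insert hi] at h ⊢
    obtain ⟨_, r, -, hr⟩ := exists_of_add_eq h
    rw [hr] at h
    rw [ih r hr]
    exact hk h

end PartialSum

open PartialSum

-- Morphisms out of finite power sets as tuples with sum `1`.

attribute [local instance] BooleanAlgebra.toEffectAlgebra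

theorem BooleanAlgebra.padd_eq_some_iff {X : Type u} [BooleanAlgebra X] {a b c : X} :
    padd a b = some c ↔ a ⊓ b = ⊥ ∧ a ⊔ b = c := by
  classical
  change (if a ⊓ b = ⊥ then some (a ⊔ b) else none) = some c ↔ _
  split_ifs with h <;> simp [h]

namespace EAHom

variable {A : Type v} [EffectAlgebra A] {α : Type u}

theorem sum_singleton (f : EAHom (Set α) A) (S : Finset α) :
    ∑ i ∈ S, of (f.toFun {i}) = of (f.toFun (S : Set α)) := by
  classical
  induction S using Finset.induction_on with
  | empty =>
    rw [Finset.sum_empty, Finset.coe_empty]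
    exact congrArg of f.map_zero.symm
  | insert i S hi ih =>
    rw [Finset.sum_insert hi, ih, Finset.coe_insert]
    refine f.map_padd (BooleanAlgebra.padd_eq_some_iff.2 ⟨?_, rfl⟩)
    exact Set.singleton_inter_eq_empty.2 hi

theorem ext_singleton [Finite α] {f g : EAHom (Set α) A}
    (h : ∀ i, f.toFun {i} = g.toFun {i}) : f = g := by
  ext X
  have hX := X.toFinite
  rw [← hX.coe_toFinset]
  refine of_injective ?_
  rw [← sum_singleton, ← sum_singleton]
  simp only [h]

/-- Since undefinedness is absorbing, a defined total sum forces every partial sum to be defined;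
the partial sums are the values of the morphism. -/
theorem exists_of_sum_eq_one [Fintype α] (a : α → A) (h : ∑ i, of (a i) = of one) :
    ∃ f : EAHom (Set α) A, ∀ S : Finset α, ∑ i ∈ S, of (a i) = of (f.toFun S) := by
  classical
  have h1 : ∀ X : Set α, ∃ s, ∑ i ∈ X.toFinset, of (a i) = of s := by
    intro X
    rw [← Finset.sum_add_sum_compl X.toFinset] at h
    obtain ⟨s, -, hs, -⟩ := exists_of_add_eq h
    exact ⟨s, hs⟩
  choose f hf using h1
  refine ⟨⟨f, of_injective ?_, fun {x y z} hxy => ?_⟩, fun S => ?_⟩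
  · rw [← hf, ← h]
    exact Finset.sum_congr (Finset.ext fun _ => iff_of_true
      (Set.mem_toFinset.2 trivial) (Finset.mem_univ _)) fun _ _ => rfl
  · obtain ⟨hd, rfl⟩ := BooleanAlgebra.padd_eq_some_iff.1 hxy
    rw [← of_add_of_eq_iff, ← hf, ← hf, ← hf, ← Finset.sum_union]
    · exact Finset.sum_congr (by ext; simp) fun _ _ => rfl
    · rw [Set.disjoint_toFinset]
      exact disjoint_iff.2 hd
  · change _ = of (f S)
    rw [← hf, Finset.toFinset_coe]

end EAHom

/-! ### Product measures from bimorphisms. -/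

namespace EABimorphism

variable {A B C : EA.{u}} (h : EABimorphism A B C)

/-- Apply additivity to `0 + 0 = 0` and cancel. -/
theorem map_zero_left (b : B.carrier) : h.toFun (zero, b) = zero :=
  eq_zero_of_padd_self (h.map_padd_left b (padd_zero zero))

theorem map_zero_right (a : A.carrier) : h.toFun (a, zero) = zero :=
  eq_zero_of_padd_self (h.map_padd_right a (padd_zero zero))

theorem sum_product {α β : Type*} (f : EAHom (Set α) A.carrier) (g : EAHom (Set β) B.carrier)
    (S : Finset α) (T : Finset β) :
    ∑ c ∈ S ×ˢ T, of (h.toFun (f.toFun {c.1}, g.toFun {c.2})) =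
      of (h.toFun (f.toFun S, g.toFun T)) := by
  rw [Finset.sum_product]
  have h1 : ∀ i, ∑ j ∈ T, of (h.toFun (f.toFun {i}, g.toFun {j})) =
      of (h.toFun (f.toFun {i}, g.toFun T)) := fun i =>
    sum_map (fun b => h.toFun (f.toFun {i}, b)) (h.map_zero_right _) (h.map_padd_right _) T _ _
      (g.sum_singleton T)
  simp only [h1]
  exact sum_map (fun a => h.toFun (a, g.toFun T)) (h.map_zero_left _) (h.map_padd_left _) S _ _
      (f.sum_singleton S)

/-- A bimorphism and measures on two finite sets induce a product measure. -/
theorem exists_product {α β γ : Type*} [Finite α] [Finite β] [Finite γ] {p : γ → α} {q : γ → β}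
    (hpq : Function.Bijective fun c => (p c, q c))
    (f : EAHom (Set α) A.carrier) (g : EAHom (Set β) B.carrier) :
    ∃ w : EAHom (Set γ) C.carrier, ∀ x y, w.toFun (p ⁻¹' x ⊓ q ⁻¹' y) =
      h.toFun (f.toFun x, g.toFun y) := by
  classical
  have := Fintype.ofFinite α
  have := Fintype.ofFinite β
  have := Fintype.ofFinite γ
  let F : α × β → PartialSum C.carrier := fun c => of (h.toFun (f.toFun {c.1}, g.toFun {c.2}))
  -- The bijection `hpq` turns the sum over a rectangle into one over `x × y`. The full rectangle
  -- then gives total sum `h(1, 1) = 1`.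
  have key : ∀ (x : Set α) (y : Set β), ∑ c ∈ (p ⁻¹' x ⊓ q ⁻¹' y).toFinset, F (p c, q c) =
      of (h.toFun (f.toFun x, g.toFun y)) := by
    intro x y
    have h1 := h.sum_product f g x.toFinset y.toFinset
    rw [Set.coe_toFinset, Set.coe_toFinset] at h1
    rw [← h1]
    refine Finset.sum_bijective _ hpq ?_ fun _ _ => rfl
    intro c
    simp
  obtain ⟨w, hw⟩ := EAHom.exists_of_sum_eq_one
    (fun c => h.toFun (f.toFun {p c}, g.toFun {q c})) (by
      have h1 := key ⊤ ⊤
      have h2 : h.toFun (f.toFun ⊤, g.toFun ⊤) = one := by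
        rw [show f.toFun ⊤ = one from f.map_one, show g.toFun ⊤ = one from g.map_one,
          h.map_one_one]
      rw [h2] at h1
      rw [← h1]
      exact Finset.sum_congr (Finset.ext fun _ => iff_of_true (Finset.mem_univ _)
        (Set.mem_toFinset.2 ⟨trivial, trivial⟩)) fun _ _ => rfl)
  refine ⟨w, fun x y => of_injective ?_⟩
  rw [← key, ← (p ⁻¹' x ⊓ q ⁻¹' y).coe_toFinset, ← hw, Finset.toFinset_coe]

end EABimorphism

/-- Every atom is a rectangle, and atoms determine a morphism. -/
theorem EAHom.ext_product {γ α β : Type*} [Finite γ] {p : γ → α} {q : γ → β}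
    (hpq : Function.Injective fun c => (p c, q c)) {A : Type u} [EffectAlgebra A]
    {f g : EAHom (Set γ) A}
    (h : ∀ x y, f.toFun (p ⁻¹' x ⊓ q ⁻¹' y) = g.toFun (p ⁻¹' x ⊓ q ⁻¹' y)) : f = g := by
  refine ext_singleton fun c => ?_
  have h1 : ({c} : Set γ) = p ⁻¹' {p c} ⊓ q ⁻¹' {q c} := by
    ext d
    exact ⟨by rintro rfl; exact ⟨rfl, rfl⟩, fun hd => hpq (Prod.ext hd.1 hd.2)⟩
  rw [h1, h]

/-! ### Rectangles in free products, and the test objects `2^[2]` and `2^[3]`. -/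

open MonoidalCategory Limits Opposite
open scoped ExternalProduct

namespace FinBool

theorem ofMap_id (n : FinBool.{u}) : ofMap id = 𝟙 n := rfl

/-- The coproduct of `2^[n]` and `2^[m]` is the algebra of subsets of a product of `[n]` and
`[m]`. -/
theorem exists_projections (n m : FinBool.{u}) :
    ∃ (p : ULift.{u} (Fin (n ⊗ m : FinBool.{u})) → ULift.{u} (Fin n))
      (q : ULift.{u} (Fin (n ⊗ m : FinBool.{u})) → ULift.{u} (Fin m)),
      (coprod.inl : n ⟶ n ⨿ m) = ofMap p ∧ (coprod.inr : m ⟶ n ⨿ m) = ofMap q ∧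
      Function.Bijective fun c => (p c, q c) := by
  obtain ⟨p, hp⟩ := exists_ofMap (coprod.inl : n ⟶ n ⨿ m)
  obtain ⟨q, hq⟩ := exists_ofMap (coprod.inr : m ⟶ n ⨿ m)
  refine ⟨p, q, hp, hq, ?_⟩
  -- The chosen coproduct is only known up to isomorphism. Its comparison `e` with the explicit one
  -- is dual to a bijection `ε` of index sets, along which bijectivity of `(p, q)` is transported.
  let e := (coprodIsCoprod n m).coconePointUniqueUpToIso (coprodCofan_isColimit n m).some
  obtain ⟨ε, hε⟩ := exists_ofMap (n := n ⨿ m) (m := prodObj n m) e.hom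
  obtain ⟨δ, hδ⟩ := exists_ofMap (n := prodObj n m) (m := n ⨿ m) e.inv
  have h1 : ε ∘ δ = id := by
    refine ofMap_injective ((ofMap_comp _ _).symm.trans ?_)
    rw [← hε, ← hδ, ofMap_id]
    exact e.hom_inv_id
  have h2 : δ ∘ ε = id := by
    refine ofMap_injective ((ofMap_comp _ _).symm.trans ?_)
    rw [← hε, ← hδ, ofMap_id]
    exact e.inv_hom_id
  have hinl : (coprod.inl : n ⟶ n ⨿ m) ≫ e.hom = (coprodCofan n m).inl :=
    (coprodIsCoprod n m).comp_coconePointUniqueUpToIso_hom _ ⟨WalkingPair.left⟩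
  have hinr : (coprod.inr : m ⟶ n ⨿ m) ≫ e.hom = (coprodCofan n m).inr :=
    (coprodIsCoprod n m).comp_coconePointUniqueUpToIso_hom _ ⟨WalkingPair.right⟩
  rw [hp, hε] at hinl
  rw [hq, hε] at hinr
  have hl := ofMap_injective ((ofMap_comp _ _).symm.trans hinl)
  have hr := ofMap_injective ((ofMap_comp _ _).symm.trans hinr)
  have hε' : Function.Bijective ε :=
    ⟨Function.LeftInverse.injective (congrFun h2), Function.RightInverse.surjective (congrFun h1)⟩
  refine (Function.Bijective.of_comp_iff (fun c => (p c, q c)) hε').1 ?_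
  have h3 : (fun c => (p c, q c)) ∘ ε = (Equiv.prodCongr Equiv.ulift.symm Equiv.ulift.symm) ∘
      (finProdFinEquiv (m := n) (n := m)).symm ∘ Equiv.ulift :=
    funext fun c => Prod.ext (congrFun hl c) (congrFun hr c)
  refine (congrArg Function.Bijective h3).mpr ?_
  exact (Equiv.bijective _).comp ((Equiv.bijective _).comp (Equiv.bijective _))

/-- The action of a morphism of finite Boolean algebras on elements. -/
abbrev app {n m : FinBool.{u}} (φ : n ⟶ m) (x : Set (ULift.{u} (Fin n))) :
    Set (ULift.{u} (Fin m)) := φ.hom.hom x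

/-- The rectangle `x * y` in the free product of two finite Boolean algebras. -/
noncomputable def rect {n m : FinBool.{u}} (x : Set (ULift.{u} (Fin n)))
    (y : Set (ULift.{u} (Fin m))) : Set (ULift.{u} (Fin (n ⊗ m : FinBool.{u}))) :=
  app (coprod.inl : n ⟶ n ⨿ m) x ⊓ app (coprod.inr : m ⟶ n ⨿ m) y

theorem app_tensorHom_rect {n m n' m' : FinBool.{u}} (φ : n ⟶ n') (ψ : m ⟶ m')
    (x : Set (ULift.{u} (Fin n))) (y : Set (ULift.{u} (Fin m))) :
    app (φ ⊗ₘ ψ) (rect x y) = rect (app φ x) (app ψ y) := by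
  refine (map_inf (φ ⊗ₘ ψ).hom.hom _ _).trans (congrArg₂ (· ⊓ ·) ?_ ?_)
  · exact congrArg (fun k => app k x) (coprod.inl_map φ ψ)
  · exact congrArg (fun k => app k y) (coprod.inr_map φ ψ)

theorem rect_top_top (n m : FinBool.{u}) :
    rect (⊤ : Set (ULift.{u} (Fin n))) (⊤ : Set (ULift.{u} (Fin m))) = ⊤ := by
  refine (congrArg₂ (· ⊓ ·) (map_top (coprod.inl : n ⟶ n ⨿ m).hom.hom)
    (map_top (coprod.inr : m ⟶ n ⨿ m).hom.hom)).trans ?_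
  exact inf_idem ⊤

theorem padd_rect_left {n m : FinBool.{u}} {x x' x'' : Set (ULift.{u} (Fin n))}
    (y : Set (ULift.{u} (Fin m))) (h : padd x x' = some x'') :
    padd (rect x y) (rect x' y) = some (rect x'' y) := by
  rw [BooleanAlgebra.padd_eq_some_iff] at h ⊢
  obtain ⟨h, rfl⟩ := h
  constructor
  · rw [rect, rect, ← inf_inf_distrib_right, app, app, ← map_inf, h, map_bot, bot_inf_eq]
  · rw [rect, rect, rect, ← inf_sup_right, app, app, app, ← map_sup]

theorem padd_rect_right {n m : FinBool.{u}} (x : Set (ULift.{u} (Fin n)))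
    {y y' y'' : Set (ULift.{u} (Fin m))} (h : padd y y' = some y'') :
    padd (rect x y) (rect x y') = some (rect x y'') := by
  rw [BooleanAlgebra.padd_eq_some_iff] at h ⊢
  obtain ⟨h, rfl⟩ := h
  constructor
  · rw [rect, rect, ← inf_inf_distrib_left, app, app, ← map_inf, h, map_bot, inf_bot_eq]
  · rw [rect, rect, rect, ← inf_sup_left, app, app, app, ← map_sup]

/-- The value of a morphism `2^[n] ⟶ A` of effect algebras. -/
abbrev val {n : FinBool.{u}} {A : EA.{u}} (f : toEA.obj n ⟶ A) (x : Set (ULift.{u} (Fin n))) :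
    A.carrier := EAHom.toFun f x

theorem hom_ext_rect {n m : FinBool.{u}} {C : EA.{u}} {s t : toEA.obj (n ⊗ m) ⟶ C}
    (h : ∀ x y, val s (rect x y) = val t (rect x y)) : s = t := by
  obtain ⟨p, q, hp, hq, hpq⟩ := exists_projections n m
  refine EAHom.ext_product (γ := ULift.{u} (Fin (n ⊗ m : FinBool.{u}))) hpq.1 fun x y => ?_
  have := h x y
  rw [rect, hp, hq] at this
  exact this

theorem exists_hom_rect {A B C : EA.{u}} (h : EABimorphism A B C) {n m : FinBool.{u}}
    (f : toEA.obj n ⟶ A) (g : toEA.obj m ⟶ B) :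
    ∃ t : toEA.obj (n ⊗ m) ⟶ C, ∀ x y, val t (rect x y) = h.toFun (val f x, val g y) := by
  obtain ⟨p, q, hp, hq, hpq⟩ := exists_projections n m
  obtain ⟨w, hw⟩ := h.exists_product (γ := ULift.{u} (Fin (n ⊗ m : FinBool.{u}))) hpq f g
  refine ⟨w, fun x y => ?_⟩
  rw [rect, hp, hq]
  exact hw x y

/-- The finite Boolean algebra `2^[k]`. -/
abbrev pow (k : ℕ) : FinBool.{u} := k

/-- The atom of `2^[k]` given by `i`. -/
abbrev atom {k : ℕ} (i : Fin k) : Set (ULift.{u} (Fin (pow.{u} k))) := {⟨i⟩}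

open Classical in
/-- The morphism `2^[2] ⟶ 2^[n]` that sends the first atom to a given element. -/
noncomputable def ofElement {n : FinBool.{u}} (x : Set (ULift.{u} (Fin n))) : pow.{u} 2 ⟶ n :=
  ofMap (n := pow 2) fun k => ⟨if k ∈ x then (0 : Fin 2) else (1 : Fin 2)⟩

theorem app_ofElement {n : FinBool.{u}} (x : Set (ULift.{u} (Fin n))) :
    app (ofElement x) (atom 0) = x := by
  classical
  ext k
  change (⟨if k ∈ x then (0 : Fin 2) else (1 : Fin 2)⟩ : ULift.{u} (Fin 2)) = ⟨0⟩ ↔ _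
  rw [ULift.up_inj]
  split_ifs with h <;> simp [h]

/-- The second atom is the orthosupplement of the first, so a morphism out of `2^[2]` amounts to one
element of `A`. -/
theorem hom_ext_pow_two {A : EA.{u}} {f g : toEA.obj (pow.{u} 2) ⟶ A}
    (h : val f (atom 0) = val g (atom 0)) : f = g := by
  refine EAHom.ext_singleton (α := ULift.{u} (Fin 2)) ?_
  have h1 : (atom 1 : Set (ULift.{u} (Fin (pow.{u} 2)))) = EffectAlgebra.compl (atom 0) := by
    refine eq_compl (BooleanAlgebra.padd_eq_some_iff.2 ⟨?_, ?_⟩)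
    · refine Set.singleton_inter_eq_empty.2 fun h => ?_
      exact absurd (ULift.up_inj.1 h) (by decide : (0 : Fin 2) ≠ 1)
    · refine Set.eq_univ_of_forall ?_
      rintro ⟨i⟩
      change Fin 2 at i
      fin_cases i
      · exact Or.inl rfl
      · exact Or.inr rfl
  rintro ⟨i⟩
  fin_cases i
  · exact h
  · change EAHom.toFun f (atom 1) = EAHom.toFun g (atom 1)
    rw [h1]
    refine (EAHom.map_compl f _).trans (Eq.trans ?_ (EAHom.map_compl g _).symm)
    exact congrArg EffectAlgebra.compl h

/-- Every defined sum in an effect algebra is the image of a sum of atoms of `2^[3]`. -/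
theorem exists_pow_three {A : EA.{u}} {a b c : A.carrier} (h : padd a b = some c) :
    ∃ (f : toEA.obj (pow.{u} 3) ⟶ A) (z : Set (ULift.{u} (Fin (pow.{u} 3)))),
      val f (atom 0) = a ∧ val f (atom 1) = b ∧ val f z = c ∧
      padd (atom 0 : Set (ULift.{u} (Fin (pow.{u} 3)))) (atom 1) = some z := by
  -- The third entry completes `a + b = c` to a sum equal to `1`.
  obtain ⟨f, hf⟩ := EAHom.exists_of_sum_eq_one (α := ULift.{u} (Fin 3))
    (fun i => ![a, b, EffectAlgebra.compl c] i.down) (by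
      refine (Equiv.sum_comp Equiv.ulift
        (fun i : Fin 3 => of (![a, b, EffectAlgebra.compl c] i))).trans ?_
      rw [Fin.sum_univ_three]
      change of a + of b + of (EffectAlgebra.compl c) = _
      rw [of_add_of_eq_iff.2 h]
      exact padd_compl c)
  have hf' : ∀ i : Fin 3, f.toFun {⟨i⟩} = ![a, b, EffectAlgebra.compl c] i := fun i => by
    have := hf {⟨i⟩}
    rw [Finset.sum_singleton, Finset.coe_singleton] at this
    exact (of_injective this).symm
  have hz : padd ({⟨0⟩} : Set (ULift.{u} (Fin 3))) {⟨1⟩} = some ({⟨0⟩} ⊔ {⟨1⟩}) := by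
    refine BooleanAlgebra.padd_eq_some_iff.2 ⟨?_, rfl⟩
    refine Set.singleton_inter_eq_empty.2 fun h => ?_
    exact absurd (ULift.up_inj.1 h) (by decide : (0 : Fin 3) ≠ 1)
  refine ⟨f, {⟨0⟩} ⊔ {⟨1⟩}, hf' 0, hf' 1, ?_, hz⟩
  have := f.map_padd hz
  rw [hf' 0, hf' 1] at this
  exact Option.some.inj (this.symm.trans h)

/-- The triple is `(a, 0, compl a)`, so `2^[3]` also serves to represent single elements. -/
theorem exists_val_eq {A : EA.{u}} (a : A.carrier) :
    ∃ f : toEA.obj (pow.{u} 3) ⟶ A, val f (atom 0) = a :=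
  let ⟨f, _, hf, _⟩ := exists_pow_three (padd_zero a)
  ⟨f, hf⟩

end FinBool

/-! ### Bimorphisms as natural transformations. -/

namespace EABimorphism

open FinBool

variable {A B C : EA.{u}}

/-- The natural transformation `R(A) ⊠ R(B) ⟶ R(C) ∘ (- * -)` that corresponds to a bimorphism. -/
noncomputable def toNatTrans (h : EABimorphism A B C) :
    EA.presheafRepr.obj A ⊠ EA.presheafRepr.obj B ⟶
      tensor FinBool.{u}ᵒᵖ ⋙ EA.presheafRepr.obj C where
  app c := TypeCat.ofHom fun s => (exists_hom_rect h (n := c.1.unop) (m := c.2.unop) s.1 s.2).choose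
  naturality c d k := by
    ext s
    -- The chosen components are determined by their values on rectangles, so naturality is tested
    -- there.
    refine hom_ext_rect (n := d.1.unop) (m := d.2.unop) fun x y => ?_
    refine ((exists_hom_rect h _ _).choose_spec x y).trans ?_
    refine Eq.trans ?_ (congrArg (val (exists_hom_rect h (n := c.1.unop) (m := c.2.unop)
      s.1 s.2).choose) (app_tensorHom_rect k.1.unop k.2.unop x y)).symm
    exact ((exists_hom_rect h (n := c.1.unop) (m := c.2.unop) s.1 s.2).choose_spec
      (app k.1.unop x) (app k.2.unop y)).symm

theorem toNatTrans_app_rect (h : EABimorphism A B C) {n m : FinBool.{u}}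
    (f : toEA.obj n ⟶ A) (g : toEA.obj m ⟶ B) (x y) :
    val (A := C) (h.toNatTrans.app (op n, op m) (f, g)) (rect x y) =
      h.toFun (val f x, val g y) :=
  (exists_hom_rect h f g).choose_spec x y

section OfNatTrans

variable (t : EA.presheafRepr.obj A ⊠ EA.presheafRepr.obj B ⟶
  tensor FinBool.{u}ᵒᵖ ⋙ EA.presheafRepr.obj C)

/-- The components of a natural transformation `R(A) ⊠ R(B) ⟶ R(C) ∘ (- * -)`. -/
def component {n m : FinBool.{u}} (f : toEA.obj n ⟶ A) (g : toEA.obj m ⟶ B) :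
    toEA.obj (n ⊗ m) ⟶ C := t.app (op n, op m) (f, g)

theorem component_comp {n m n' m' : FinBool.{u}} (f : toEA.obj n ⟶ A) (g : toEA.obj m ⟶ B)
    (φ : n' ⟶ n) (ψ : m' ⟶ m) (x y) :
    val (component t (toEA.map φ ≫ f) (toEA.map ψ ≫ g)) (rect x y) =
      val (component t f g) (rect (app φ x) (app ψ y)) := by
  rw [← app_tensorHom_rect]
  let k : ((op n, op m) : FinBool.{u}ᵒᵖ × FinBool.{u}ᵒᵖ) ⟶ (op n', op m') := (φ.op, ψ.op)
  exact congrArg (fun r : toEA.obj (n' ⊗ m') ⟶ C => val r (rect x y))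
    (ConcreteCategory.congr_hom (C := Type u) (t.naturality k)
      (show (EA.presheafRepr.obj A ⊠ EA.presheafRepr.obj B).obj (op n, op m) from (f, g)))

/-- Precomposing with the map `2^[2] ⟶ 2^[n]` that picks out `x` leaves a morphism that knows only
`f x`. Naturality computes both sides from these restrictions, which agree. This makes `ofNatTrans`
independent of the chosen representatives. -/
theorem component_rect_congr {n m n' m' : FinBool.{u}} {f : toEA.obj n ⟶ A} {g : toEA.obj m ⟶ B}
    {f' : toEA.obj n' ⟶ A} {g' : toEA.obj m' ⟶ B} {x y x' y'} (hx : val f x = val f' x')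
    (hy : val g y = val g' y') :
    val (component t f g) (rect x y) = val (component t f' g') (rect x' y') := by
  have h1 : toEA.map (ofElement x) ≫ f = toEA.map (ofElement x') ≫ f' := by
    refine hom_ext_pow_two ?_
    change val f (app (ofElement x) (atom 0)) = val f' (app (ofElement x') (atom 0))
    rw [app_ofElement, app_ofElement, hx]
  have h2 : toEA.map (ofElement y) ≫ g = toEA.map (ofElement y') ≫ g' := by
    refine hom_ext_pow_two ?_
    change val g (app (ofElement y) (atom 0)) = val g' (app (ofElement y') (atom 0))
    rw [app_ofElement, app_ofElement, hy]
  have h3 := component_comp t f g (ofElement x) (ofElement y) (atom 0) (atom 0)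
  rw [h1, h2, component_comp] at h3
  simpa only [app_ofElement] using h3.symm

/-- The bimorphism that corresponds to a natural transformation
`R(A) ⊠ R(B) ⟶ R(C) ∘ (- * -)`. -/
noncomputable def ofNatTrans : EABimorphism A B C where
  toFun c := val (component t (exists_val_eq c.1).choose (exists_val_eq c.2).choose)
    (rect (atom 0) (atom 0))
  map_one_one := by
    -- The element `1` is also the value at `⊤`, so the atoms may be replaced by `⊤`, whose
    -- rectangle is `⊤`.
    have h1 : ∀ D : EA.{u}, val (exists_val_eq (one : D.carrier)).choose (atom 0) =
        val (exists_val_eq (one : D.carrier)).choose ⊤ := fun D =>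
      (exists_val_eq (one : D.carrier)).choose_spec.trans
        (EAHom.map_one (exists_val_eq (one : D.carrier)).choose).symm
    refine (component_rect_congr t (h1 A) (h1 B)).trans ?_
    rw [rect_top_top]
    exact EAHom.map_one (component t _ _)
  map_padd_left b {a₁ a₂ a} h := by
    obtain ⟨f, z, h1, h2, h3, hz⟩ := exists_pow_three h
    -- All three elements are now represented by the same `f` on `2^[3]`, where additivity is that
    -- of rectangles.
    have key : ∀ {a : A.carrier} {x}, val f x = a →
        val (component t (exists_val_eq a).choose (exists_val_eq b).choose)
          (rect (atom 0) (atom 0)) =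
        val (component t f (exists_val_eq b).choose) (rect x (atom 0)) := fun hx =>
      component_rect_congr t ((exists_val_eq _).choose_spec.trans hx.symm) rfl
    rw [key h1, key h2, key h3]
    exact EAHom.map_padd (component t f _) (padd_rect_left (atom 0) hz)
  map_padd_right a {b₁ b₂ b} h := by
    obtain ⟨g, z, h1, h2, h3, hz⟩ := exists_pow_three h
    have key : ∀ {b : B.carrier} {y}, val g y = b →
        val (component t (exists_val_eq a).choose (exists_val_eq b).choose)
          (rect (atom 0) (atom 0)) =
        val (component t (exists_val_eq a).choose g) (rect (atom 0) y) := fun hy =>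
      component_rect_congr t rfl ((exists_val_eq _).choose_spec.trans hy.symm)
    rw [key h1, key h2, key h3]
    exact EAHom.map_padd (component t _ g) (padd_rect_right (atom 0) hz)

theorem ofNatTrans_val {n m : FinBool.{u}} (f : toEA.obj n ⟶ A) (g : toEA.obj m ⟶ B) (x y) :
    (ofNatTrans t).toFun (val f x, val g y) = val (component t f g) (rect x y) :=
  component_rect_congr t (exists_val_eq (val f x)).choose_spec (exists_val_eq (val g y)).choose_spec

end OfNatTrans

/-- Bimorphisms correspond to natural transformations `R(A) ⊠ R(B) ⟶ R(C) ∘ (- * -)`. -/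
noncomputable def natTransEquiv (A B C : EA.{u}) :
    (EA.presheafRepr.obj A ⊠ EA.presheafRepr.obj B ⟶
      tensor FinBool.{u}ᵒᵖ ⋙ EA.presheafRepr.obj C) ≃ EABimorphism A B C where
  toFun := ofNatTrans
  invFun := toNatTrans
  left_inv t := by
    ext c s
    refine hom_ext_rect (n := c.1.unop) (m := c.2.unop) fun x y => ?_
    exact ((ofNatTrans t).toNatTrans_app_rect (n := c.1.unop) (m := c.2.unop) s.1 s.2 x y).trans
      (ofNatTrans_val t (n := c.1.unop) (m := c.2.unop) s.1 s.2 x y)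
  right_inv h := by
    ext ⟨a, b⟩
    refine (toNatTrans_app_rect h (exists_val_eq a).choose (exists_val_eq b).choose _ _).trans ?_
    rw [(exists_val_eq a).choose_spec, (exists_val_eq b).choose_spec]

/-- `L(R(A) ⊗ R(B))` corepresents bimorphisms from `A, B`. -/
noncomputable def corepresentableBy (A B : EA.{u}) {L : (FinBool.{u}ᵒᵖ ⥤ Type u) ⥤ EA.{u}}
    (adj : L ⊣ EA.presheafRepr.{u})
    (D : DayConvolution (EA.presheafRepr.obj A) (EA.presheafRepr.obj B)) :
    (EABimorphism.functor A B).CorepresentableBy (L.obj D.convolution) where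
  homEquiv {C} := (adj.homEquiv _ C).trans
    ((DayConvolution.corepresentableBy (EA.presheafRepr.obj A)
      (EA.presheafRepr.obj B)).homEquiv.trans
      (natTransEquiv A B C))
  homEquiv_comp {C C'} k f := by
    change natTransEquiv A B C' ((DayConvolution.corepresentableBy (EA.presheafRepr.obj A)
      (EA.presheafRepr.obj B)).homEquiv (adj.homEquiv _ C' (f ≫ k))) = _
    rw [adj.homEquiv_naturality_right, Functor.CorepresentableBy.homEquiv_comp]
    rfl

end EABimorphism

/-! ### Existence of the Day convolution and the final comparison. -/

theorem EA.nonempty_dayConvolution (X Y : FinBool.{u}ᵒᵖ ⥤ Type u) :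
    Nonempty (DayConvolution X Y) :=
  ⟨{ convolution := (tensor FinBool.{u}ᵒᵖ).pointwiseLeftKanExtension (X ⊠ Y)
     unit := (tensor FinBool.{u}ᵒᵖ).pointwiseLeftKanExtensionUnit (X ⊠ Y)
     isPointwiseLeftKanExtensionUnit :=
      (tensor FinBool.{u}ᵒᵖ).pointwiseLeftKanExtensionIsPointwiseLeftKanExtension (X ⊠ Y) }⟩

theorem mainTheorem2 :
    EA.presheafRepr.{u}.IsRightAdjoint ∧
    ∀ A B : EA.{u},
      (∃ T : EABimorphismCat A B, Nonempty (IsEATensorProduct T)) ∧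
      Nonempty (MonoidalCategory.DayConvolution (EA.presheafRepr.obj A) (EA.presheafRepr.obj B)) ∧
      ∀ (T : EABimorphismCat A B) (_ : IsEATensorProduct T)
        (L : (FinBool.{u}ᵒᵖ ⥤ Type u) ⥤ EA.{u}) (_ : L ⊣ EA.presheafRepr.{u})
        (D : MonoidalCategory.DayConvolution (EA.presheafRepr.obj A) (EA.presheafRepr.obj B)),
        Nonempty (T.1 ≅ L.obj D.convolution) := by
  have hR := EA.presheafRepr_isRightAdjoint.{u}
  refine ⟨hR, fun A B => ?_⟩
  obtain ⟨D⟩ := EA.nonempty_dayConvolution (EA.presheafRepr.obj A) (EA.presheafRepr.obj B)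
  refine ⟨⟨_, ⟨Functor.Elements.isInitialOfCorepresentableBy
    (EABimorphism.corepresentableBy A B (Adjunction.ofIsRightAdjoint _) D)⟩⟩, ⟨D⟩, ?_⟩
  intro T hT L adj D
  -- A corepresenting object is an initial object of the category of elements; the isomorphism of
  -- initial objects is projected to `EA`.
  exact ⟨(CategoryOfElements.π _).mapIso (hT.uniqueUpToIso
    (Functor.Elements.isInitialOfCorepresentableBy (EABimorphism.corepresentableBy A B adj D)))⟩
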